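/- Let $\mathcal A$ be a set of agents, $\mathcal I$ a set of institutions and $\mathcal X$ a finite set of contracts; each contract $x$ names one agent $\alpha(x)\in\mathcal A$ and one institution. For $X\subseteq\mathcal X$, let $X_a$ and $X_i$ denote the sets of contracts in $X$ that name agent $a$ and institution $i$, respectively. For each $i\in\mathcal I$, let $\mathcal F_i$ be the collection of feasible subsets of $\mathcal X_i$, where $(\mathcal X_i,\mathcal F_i)$ is a matroid with independent sets $\mathcal F_i$ and rank function $r_i$, and let $\succ_i$ be a (strict) linear order over $\mathcal X_i$, the priority ordering. A matching is a set $X\subseteq\mathcal X$ with $|X_a|\le 1$ for all $a\in\mathcal A$. A problem is a profile $R=(R_a)_{a\in\mathcal A}$ in which $R_a$ is a linear order over $\mathcal X_a\cup\{\emptyset\}$, with strict part $P_a$, where $\emptyset$ is the null contract (being unassigned). A contract $x\in\mathcal X_a$ is acceptable if $x\mathrel{R_a}\emptyset$. At a matching $X$, $X_a$ also denotes the contract of $a$ in $X$, or $\emptyset$ if there is none. A matching rule $\varphi$ assigns a matching $\varphi(R)$ to every problem $R$. *Greedy rule.* For $Y\subseteq\mathcal X_i$, go through the elements of $Y$ from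 the highest to the lowest priority under $\succ_i$, starting from the empty set, and add an element to the set chosen so far if and only if the resulting set is in $\mathcal F_i$. The final set is $G_i(Y)$. *Deferred acceptance (DA) based on $G=(G_i)_{i\in\mathcal I}$.* At step 1, each agent proposes their most preferred acceptable contract (if any). At each later step, each agent whose contract was rejected at the previous step proposes their next most preferred acceptable contract (if any). At each step, each institution $i$ considers the set $Y$ of the contracts it tentatively accepted at the previous step together with its new proposals, tentatively accepts $G_i(Y)$, and permanently rejects $Y\setminus G_i(Y)$. The algorithm stops at the first step without a rejection, and its outcome is the set of the contracts accepted at that step. **Statement.** A matching rule $\varphi$ satisfies conditions (i)–(iv) for the matching $X=\varphi(R)$ at every problem $R$, and condition (v), - (i) feasibility: $X_i\in\mathcal F_i$ for all $i\in\mathcal I$; - (ii) rank maximality: for all $i\in\mathcal I$ and $x\in\mathcal X_i\setminus X_i$ with $x\mathrel{P_{\alpha(x)}}X_{\alpha(x)}$, $r_i(X_i\cup\{x\})=r_i(X_i)$; - (iii) no justified envy under rank: for all $i\in\mathcal I$, $x\in X_i$ and $y\in\mathcal X_i\setminus X_i$ with $y\mathrel{P_{\alpha(y)}}X_{\alpha(y)}$,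 if $y\succ_i x$ then $r_i((X_i\setminus\{x\})\cup\{y\})<r_i(X_i)$; - (iv) individual rationality: $X_a\mathrel{R_a}\emptyset$ for all $a\in\mathcal A$; - (v) strategy-proofness: for every problem $R$, every agent $a$ and every linear order $R'_a$ over $\mathcal X_a\cup\{\emptyset\}$, $\varphi_a(R)\mathrel{R_a}\varphi_a(R'_a,R_{-a})$, where $\varphi_a(R)$ denotes the assignment of $a$ at $\varphi(R)$ and $R_{-a}$ the preferences of the other agents; if and only if $\varphi$ is the DA rule based on $G$. -/

import Mathlib

/-!
Matching with contracts. `A` is the set of agents, `I` the set of institutions and `X` the finite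
set of contracts; `agent x` and `inst x` are the agent and the institution of the contract `x`.
-/

namespace MatchingContracts

universe u v w

/-- A linear order on `α`, given by its weak relation; `weak x y` reads "`x` is at least as good
as `y`" (for a preference) or "`x` has at least the priority of `y`" (for a priority ordering). -/
structure LinPref (α : Type u) where
  weak : α → α → Prop
  total : ∀ x y, weak x y ∨ weak y x
  trans : ∀ x y z, weak x y → weak y z → weak x z
  antisymm : ∀ x y, weak x y → weak y x → x = y

/-- The strict part of a linear order. -/
def LinPref.strict {α : Type u} (r : LinPref α) (x y : α) : Prop :=
  r.weak x y ∧ x ≠ y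

theorem LinPref.strict_trans {α : Type u} (r : LinPref α) {x y z : α}
    (h₁ : r.strict x y) (h₂ : r.strict y z) : r.strict x z := by
  refine ⟨r.trans _ _ _ h₁.1 h₂.1, ?_⟩
  rintro rfl
  exact h₁.2 (r.antisymm _ _ h₁.1 h₂.1)

/-- A choice rule on `α`: it chooses a subset of every set of contracts. -/
structure ChoiceRule (α : Type u) where
  choose : Set α → Set α
  choose_subset : ∀ S, choose S ⊆ S

/-! ### The greedy choice rule of a matroid -/

section Greedy

variable {α : Type u}

/-- The set chosen after `s` steps of the greedy procedure on the set `S`. The element considered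
at step `s + 1` is the `(s + 1)`-st highest priority element of `S`, that is, the element of `S`
which has exactly `s` elements of `S` above it. -/
def greedyStage (M : Matroid α) (p : LinPref α) (S : Set α) : ℕ → Set α
  | 0 => ∅
  | s + 1 => greedyStage M p S s ∪
      {x | x ∈ S ∧ {y | y ∈ S ∧ p.strict y x}.encard = (s : ℕ∞) ∧
        M.Indep (insert x (greedyStage M p S s))}

theorem greedyStage_subset (M : Matroid α) (p : LinPref α) (S : Set α) (s : ℕ) :
    greedyStage M p S s ⊆ S := by
  induction s with
  | zero => exact Set.empty_subset _
  | succ s ih => exact Set.union_subset ih (fun _ hx => hx.1)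

/-- The greedy choice rule: the outcome of the greedy procedure after `|S|` steps. -/
noncomputable def greedyRule (M : Matroid α) (p : LinPref α) : ChoiceRule α where
  choose S := greedyStage M p S S.ncard
  choose_subset S := greedyStage_subset M p S _

end Greedy

section Model

variable {A : Type u} {I : Type v} {X : Type w}

/-- The contracts of agent `a`. -/
abbrev AgentContract (agent : X → A) (a : A) : Type w := {x : X // agent x = a}

/-- The contracts of institution `i`. -/
abbrev InstContract (inst : X → I) (i : I) : Type w := {x : X // inst x = i}

/-- The set of contracts in `Y` that include institution `i`. -/
def instPart (inst : X → I) (Y : Set X) (i : I) : Set (InstContract inst i) :=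
  {x | (x : X) ∈ Y}

/-- The set of contracts in `Y` that include agent `a`. -/
def agentPart (agent : X → A) (Y : Set X) (a : A) : Set (AgentContract agent a) :=
  {x | (x : X) ∈ Y}

/-- A matching problem: for every agent a linear order over the contracts of this agent and the
null contract `none`. -/
abbrev Profile (agent : X → A) : Type (max u w) :=
  ∀ a : A, LinPref (Option (AgentContract agent a))

/-- A matching: a set of contracts with at most one contract for each agent. -/
structure Matching (agent : X → A) where
  contracts : Set X
  card_le_one : ∀ a : A, (agentPart agent contracts a).encard ≤ 1

theorem card_le_one_iff (agent : X → A) (Y : Set X) :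
    (∀ a : A, (agentPart agent Y a).encard ≤ 1) ↔
      ∀ x ∈ Y, ∀ y ∈ Y, agent x = agent y → x = y := by
  constructor
  · intro h x hx y hy hxy
    have := Set.encard_le_one_iff.1 (h (agent y)) ⟨x, hxy⟩ ⟨y, rfl⟩ hx hy
    exact congrArg Subtype.val this
  · intro h a
    refine Set.encard_le_one_iff.2 ?_
    rintro ⟨x, rfl⟩ ⟨y, hya⟩ hx hy
    exact Subtype.ext (h x hx y hy hya.symm)

open Classical in
/-- The assignment of agent `a` at a matching: the contract of `a` in the matching, or the null
contract if there is none. -/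
noncomputable def Matching.assignment {agent : X → A} (μ : Matching agent) (a : A) :
    Option (AgentContract agent a) :=
  if h : (agentPart agent μ.contracts a).Nonempty then some h.some else none

/-- The agent of the contract `x` strictly prefers `x` to their assignment at `μ`. -/
def PrefersToAssignment {agent : X → A} (R : Profile agent) (μ : Matching agent) (x : X) : Prop :=
  (R (agent x)).strict (some ⟨x, rfl⟩) (μ.assignment (agent x))

/-- A matching rule associates a matching with each matching problem. -/
abbrev MatchingRule (agent : X → A) : Type (max u w) := Profile agent → Matching agent

/-! ### Axioms on matchings -/

/-- Individual rationality of a matching. -/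
def IndividuallyRational {agent : X → A} (R : Profile agent) (μ : Matching agent) : Prop :=
  ∀ a : A, (R a).weak (μ.assignment a) none

/-- Feasibility of a matching: the feasible sets of institution `i` are the independent sets
of `M i`. -/
def Feasible {agent : X → A} (inst : X → I) (M : ∀ i, Matroid (InstContract inst i))
    (μ : Matching agent) : Prop :=
  ∀ i, (M i).Indep (instPart inst μ.contracts i)

/-- Rank maximality of a matching. -/
def RankMaximal {agent : X → A} (inst : X → I) (M : ∀ i, Matroid (InstContract inst i))
    (R : Profile agent) (μ : Matching agent) : Prop :=
  ∀ i, ∀ x : InstContract inst i, x ∉ instPart inst μ.contracts i →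
    PrefersToAssignment R μ x →
      (M i).eRk (instPart inst μ.contracts i ∪ {x}) = (M i).eRk (instPart inst μ.contracts i)

/-- No justified envy under rank of a matching. -/
def NoJustifiedEnvyUnderRank {agent : X → A} (inst : X → I)
    (M : ∀ i, Matroid (InstContract inst i)) (prio : ∀ i, LinPref (InstContract inst i))
    (R : Profile agent) (μ : Matching agent) : Prop :=
  ∀ i, ∀ x ∈ instPart inst μ.contracts i, ∀ y : InstContract inst i,
    y ∉ instPart inst μ.contracts i → PrefersToAssignment R μ y → (prio i).strict y x →
      (M i).eRk ((instPart inst μ.contracts i \ {x}) ∪ {y}) <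
        (M i).eRk (instPart inst μ.contracts i)

open Classical in
/-- Strategy-proofness of a matching rule. -/
def StrategyProof {agent : X → A} (φ : MatchingRule agent) : Prop :=
  ∀ (R : Profile agent) (a : A) (Ra' : LinPref (Option (AgentContract agent a))),
    (R a).weak ((φ R).assignment a) ((φ (Function.update R a Ra')).assignment a)

/-! ### The deferred-acceptance rule -/

/-- The contract `x` is acceptable to its agent. -/
def Acceptable {agent : X → A} (R : Profile agent) (x : X) : Prop :=
  (R (agent x)).weak (some ⟨x, rfl⟩) none

/-- `x` is the most preferred acceptable contract of its agent. -/
def IsTop {agent : X → A} (R : Profile agent) (x : X) : Prop :=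
  Acceptable R x ∧ ∀ z, ∀ hz : agent z = agent x, Acceptable R z →
    (R (agent x)).weak (some ⟨x, rfl⟩) (some ⟨z, hz⟩)

/-- `x` is the next most preferred acceptable contract after `y` of their common agent. -/
def IsNext {agent : X → A} (R : Profile agent) (y x : X) : Prop :=
  ∃ h : agent y = agent x, Acceptable R x ∧
    (R (agent x)).strict (some ⟨y, h⟩) (some ⟨x, rfl⟩) ∧
    ∀ z, ∀ hz : agent z = agent x, Acceptable R z →
      (R (agent x)).strict (some ⟨y, h⟩) (some ⟨z, hz⟩) →
        (R (agent x)).weak (some ⟨x, rfl⟩) (some ⟨z, hz⟩)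

/-- The contracts accepted when each institution `i` applies its choice rule to its contracts
in `Y`. -/
def accepted {inst : X → I} (C : ∀ i, ChoiceRule (InstContract inst i)) (Y : Set X) : Set X :=
  {x | (⟨x, rfl⟩ : InstContract inst (inst x)) ∈ (C (inst x)).choose (instPart inst Y (inst x))}

theorem accepted_subset {inst : X → I} (C : ∀ i, ChoiceRule (InstContract inst i)) (Y : Set X) :
    accepted C Y ⊆ Y := fun _ hx => (C _).choose_subset _ hx

/-- `considered C R s` is the set of contracts considered by the institutions at step `s + 1` of
the deferred-acceptance algorithm: at the first step the most preferred acceptable contract of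
each agent; at a later step the tentatively accepted contracts of the previous step, together
with the next most preferred acceptable contract of each agent who was rejected in that step. -/
def considered {agent : X → A} {inst : X → I} (C : ∀ i, ChoiceRule (InstContract inst i))
    (R : Profile agent) : ℕ → Set X
  | 0 => {x | IsTop R x}
  | s + 1 => accepted C (considered C R s) ∪
      {x | ∃ y ∈ considered C R s \ accepted C (considered C R s), IsNext R y x}

/-- The contracts rejected at step `s + 1` of the deferred-acceptance algorithm. -/
def rejected {agent : X → A} {inst : X → I} (C : ∀ i, ChoiceRule (InstContract inst i))
    (R : Profile agent) (s : ℕ) : Set X :=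
  considered C R s \ accepted C (considered C R s)

theorem considered_unique {agent : X → A} {inst : X → I}
    (C : ∀ i, ChoiceRule (InstContract inst i)) (R : Profile agent) (s : ℕ) :
    ∀ x ∈ considered C R s, ∀ y ∈ considered C R s, agent x = agent y → x = y := by
  induction s with
  | zero =>
    rintro x ⟨hx, hx'⟩ y ⟨hy, hy'⟩ hxy
    have h₁ := hx' y hxy.symm hy
    have h₂ := hy' x hxy hx
    generalize_proofs at h₁ h₂
    have h₃ : ∀ a (ha : agent x = a) (hb : agent y = a),
        (R a).weak (some ⟨y, hb⟩) (some ⟨x, ha⟩) := by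
      rintro a ha rfl; exact h₂
    have := (R (agent x)).antisymm _ _ h₁ (h₃ _ rfl hxy.symm)
    simpa using this
  | succ s ih =>
    have key : ∀ x y z : X, IsNext R z x → IsNext R z y → x = y := by
      rintro x y z ⟨hx, hax, hsx, hmx⟩ ⟨hy, hay, hsy, hmy⟩
      have h₁ : ∀ a (hza : agent z = a) (hxa : agent x = a) (hya : agent y = a),
          (R a).weak (some ⟨x, hxa⟩) (some ⟨y, hya⟩) := by
        rintro a hza rfl hya
        refine hmx y hya hay ?_
        have : ∀ b (hzb : agent z = b) (hyb : agent y = b),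
            (R b).strict (some ⟨z, hzb⟩) (some ⟨y, hyb⟩) := by
          rintro b hzb rfl; exact hsy
        exact this _ _ _
      have h₂ : ∀ a (hza : agent z = a) (hxa : agent x = a) (hya : agent y = a),
          (R a).weak (some ⟨y, hya⟩) (some ⟨x, hxa⟩) := by
        rintro a hza hxa rfl
        refine hmy x hxa hax ?_
        have : ∀ b (hzb : agent z = b) (hxb : agent x = b),
            (R b).strict (some ⟨z, hzb⟩) (some ⟨x, hxb⟩) := by
          rintro b hzb rfl; exact hsx
        exact this _ _ _
      have := (R (agent z)).antisymm _ _ (h₁ _ rfl hx.symm hy.symm) (h₂ _ rfl hx.symm hy.symm)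
      simpa using this
    rintro x (hx | ⟨z, hz, hx⟩) y (hy | ⟨w, hw, hy⟩) hxy
    · exact ih x (accepted_subset C _ hx) y (accepted_subset C _ hy) hxy
    · have := ih x (accepted_subset C _ hx) w hw.1 (hxy.trans hy.1.symm)
      exact absurd (this ▸ hx) hw.2
    · have := ih y (accepted_subset C _ hy) z hz.1 (hxy.symm.trans hx.1.symm)
      exact absurd (this ▸ hy) hz.2
    · have : z = w := ih z hz.1 w hw.1 (hx.1.trans (hxy.trans hy.1.symm))
      subst this
      exact key x y z hx hy

theorem rejected_strict {agent : X → A} {inst : X → I}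
    (C : ∀ i, ChoiceRule (InstContract inst i)) (R : Profile agent) (s k : ℕ) :
    ∀ y ∈ rejected C R s, ∀ x ∈ considered C R (s + 1 + k), ∀ h : agent y = agent x,
      (R (agent x)).strict (some ⟨y, h⟩) (some ⟨x, rfl⟩) := by
  induction k with
  | zero =>
    rintro y hy x (hx | ⟨z, hz, hx⟩) h
    · have := considered_unique C R s y hy.1 x (accepted_subset C _ hx) h
      exact absurd (this ▸ hx) hy.2
    · have : z = y := considered_unique C R s z hz.1 y hy.1 (hx.1.trans h.symm)
      subst this
      exact hx.2.2.1
  | succ k ih =>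
    rintro y hy x (hx | ⟨z, hz, hx⟩) h
    · exact ih y hy x (accepted_subset C _ hx) h
    · have hyz : ∀ a (hya : agent y = a) (hza : agent z = a),
          (R a).strict (some ⟨y, hya⟩) (some ⟨z, hza⟩) := by
        rintro a hya rfl
        exact ih y hy z hz.1 hya
      exact (R (agent x)).strict_trans (hyz _ h hx.1) hx.2.2.1

/-- The deferred-acceptance algorithm stops. -/
theorem exists_rejected_eq_empty [Finite X] {agent : X → A} {inst : X → I}
    (C : ∀ i, ChoiceRule (InstContract inst i)) (R : Profile agent) :
    ∃ s, rejected C R s = ∅ := by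
  by_contra! hne
  choose f hf using hne
  have hlt : ∀ s t, s < t → f s ≠ f t := by
    intro s t hst heq
    obtain ⟨k, rfl⟩ := Nat.exists_eq_add_of_le (Nat.succ_le_of_lt hst)
    have hc : f s ∈ considered C R (s + 1 + k) := by
      rw [heq]; exact (hf (s + 1 + k)).1
    exact (rejected_strict C R s k (f s) (hf s) (f s) hc rfl).2 rfl
  refine not_injective_infinite_finite f fun s t hst => ?_
  rcases lt_trichotomy s t with h | h | h
  · exact absurd hst (hlt s t h)
  · exact h
  · exact absurd hst.symm (hlt t s h)

open Classical in
/-- The deferred-acceptance rule based on the choice rule profile `C`: the matching of the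
contracts accepted at the first step at which no contract is rejected. -/
noncomputable def deferredAcceptance [Finite X] {agent : X → A} {inst : X → I}
    (C : ∀ i, ChoiceRule (InstContract inst i)) : MatchingRule agent := fun R =>
  { contracts := accepted C (considered C R (Nat.find (exists_rejected_eq_empty C R)))
    card_le_one := (card_le_one_iff agent _).2 fun x hx y hy hxy =>
      considered_unique C R _ x (accepted_subset C _ hx) y (accepted_subset C _ hy) hxy }

end Model

end MatchingContracts

open MatchingContracts

/-!
The greedy procedure keeps `x` exactly when `x` is independent of the kept elements of higher
priority. A fundamental circuit argument turns this into the rank conditions of the theorem: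
feasibility, rank maximality and no justified envy hold together if and only if the institutions,
offered all contracts which their agents weakly desire, choose exactly the matching. With individual
rationality this is stability with respect to the greedy rules. These rules are substitutable,
because the kept elements of higher priority than `x` span all offered elements of higher priority
than `x`, and size monotonic, because they choose a basis of the offered set.

For such choice rules deferred acceptance gives the agent-optimal stable matching, and all stable
matchings leave the same agents unassigned (the rural hospitals theorem). Suppose that an agent
truncates their preference at a contract. If they have it at some stable matching, this matching
remains stable, so a stable rule gives them a contract at least as good; hence a stable
strategy-proof rule is at least as good for the agent as deferred acceptance, and so equal to it. If
they strictly prefer it to their deferred acceptance assignment, they end up unassigned; hence no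
misreport can gain it.
-/

namespace MatchingContracts

section LinPref

variable {α : Type*} (r : LinPref α) {x y z : α}

theorem LinPref.weak_refl (x : α) : r.weak x x := (r.total x x).elim id id

theorem LinPref.not_strict_iff : ¬ r.strict x y ↔ r.weak y x := by
  refine ⟨fun h => ?_, fun h hxy => hxy.2 (r.antisymm _ _ hxy.1 h)⟩
  by_cases hxy : x = y
  · exact hxy ▸ r.weak_refl x
  · exact (r.total x y).resolve_left fun h' => h ⟨h', hxy⟩

theorem LinPref.not_weak_iff : ¬ r.weak x y ↔ r.strict y x := by
  rw [← r.not_strict_iff, not_not]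

theorem LinPref.strict_irrefl (x : α) : ¬ r.strict x x := fun h => h.2 rfl

theorem LinPref.strict_of_strict_of_weak (hxy : r.strict x y) (hyz : r.weak y z) :
    r.strict x z := by
  rw [← r.not_weak_iff] at hxy ⊢
  exact fun hzx => hxy (r.trans _ _ _ hyz hzx)

/-- The `LinearOrder` of `r`, in which better elements are larger. -/
noncomputable abbrev LinPref.toLinearOrder : LinearOrder α where
  le x y := r.weak y x
  le_refl := r.weak_refl
  le_trans x y z hxy hyz := r.trans z y x hyz hxy
  le_antisymm x y hxy hyx := r.antisymm x y hyx hxy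
  le_total x y := r.total y x
  toDecidableLE := Classical.decRel _

theorem LinPref.exists_best {S : Set α} (hfin : S.Finite) (hS : S.Nonempty) :
    ∃ x ∈ S, ∀ y ∈ S, r.weak x y :=
  let _ := r.toLinearOrder
  Set.exists_max_image S id hfin hS

theorem LinPref.exists_worst {S : Set α} (hfin : S.Finite) (hS : S.Nonempty) :
    ∃ x ∈ S, ∀ y ∈ S, r.weak y x :=
  let _ := r.toLinearOrder
  Set.exists_min_image S id hfin hS

end LinPref

section Greedy

variable {α : Type*} {M : Matroid α} {p : LinPref α} {S T Y Z : Set α} {x y : α} {s : ℕ}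

/-- The elements of `S` of higher priority than `x`: those considered before `x` by the greedy
procedure on `S`. -/
def LinPref.above (p : LinPref α) (S : Set α) (x : α) : Set α := {y | y ∈ S ∧ p.strict y x}

theorem LinPref.above_subset : p.above S x ⊆ S := fun _ hy => hy.1

theorem LinPref.above_subset_above (h : p.weak x y) : p.above S x ⊆ p.above S y :=
  fun _ hz => ⟨hz.1, p.strict_of_strict_of_weak hz.2 h⟩

theorem LinPref.notMem_above_self : x ∉ p.above S x := fun h => p.strict_irrefl x h.2

theorem LinPref.encard_above_lt (hS : S.Finite) (hx : x ∈ S) :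
    (p.above S x).encard < S.encard :=
  (hS.subset LinPref.above_subset).encard_lt_encard
    (LinPref.above_subset.ssubset_of_mem_notMem hx LinPref.notMem_above_self)

theorem LinPref.encard_above_lt_encard_above_iff (hS : S.Finite) (hx : x ∈ S) :
    (p.above S x).encard < (p.above S y).encard ↔ p.strict x y := by
  constructor
  · intro h
    by_contra hxy
    exact h.not_ge (Set.encard_le_encard (LinPref.above_subset_above (p.not_strict_iff.1 hxy)))
  · intro h
    exact (hS.subset LinPref.above_subset).encard_lt_encard
      ((LinPref.above_subset_above h.1).ssubset_of_mem_notMem ⟨hx, h⟩ LinPref.notMem_above_self)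

theorem mem_greedyStage_iff :
    x ∈ greedyStage M p S s ↔ ∃ t < s, x ∈ S ∧ (p.above S x).encard = (t : ℕ∞) ∧
      M.Indep (insert x (greedyStage M p S t)) := by
  induction s with
  | zero => simp [greedyStage]
  | succ s ih =>
    rw [Nat.exists_lt_succ_right, ← ih]
    rfl

theorem greedyStage_eq_above (hS : S.Finite) (hx : (p.above S x).encard = (s : ℕ∞)) :
    greedyStage M p S s = p.above ((greedyRule M p).choose S) x := by
  ext y
  change _ ↔ y ∈ greedyStage M p S S.ncard ∧ p.strict y x
  rw [mem_greedyStage_iff, mem_greedyStage_iff]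
  constructor
  · rintro ⟨t, hts, hy, hyt, hind⟩
    rw [← ENat.natCast_lt_natCast, ← hyt, ← hx,
      LinPref.encard_above_lt_encard_above_iff hS hy] at hts
    refine ⟨⟨t, ?_, hy, hyt, hind⟩, hts⟩
    rw [← ENat.natCast_lt_natCast, ← hyt, hS.cast_ncard_eq]
    exact LinPref.encard_above_lt hS hy
  · rintro ⟨⟨t, -, hy, hyt, hind⟩, hyx⟩
    refine ⟨t, ?_, hy, hyt, hind⟩
    rw [← ENat.natCast_lt_natCast, ← hyt, ← hx]
    exact (LinPref.encard_above_lt_encard_above_iff hS hy).2 hyx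

/-- The outcome `Y` of the greedy procedure on `S`, described without steps: an element of `S`
belongs to `Y` if and only if it is independent of the elements of `Y` of higher priority. -/
def IsGreedyChoice (M : Matroid α) (p : LinPref α) (S Y : Set α) : Prop :=
  ∀ x, x ∈ Y ↔ x ∈ S ∧ M.Indep (insert x (p.above Y x))

theorem isGreedyChoice_greedyRule (hS : S.Finite) :
    IsGreedyChoice M p S ((greedyRule M p).choose S) := by
  intro x
  constructor
  · intro hx
    obtain ⟨t, -, hxS, hxt, hind⟩ := mem_greedyStage_iff.1 hx
    exact ⟨hxS, greedyStage_eq_above hS hxt ▸ hind⟩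
  · rintro ⟨hxS, hind⟩
    have hxt : (p.above S x).encard = ((p.above S x).ncard : ℕ∞) :=
      (hS.subset LinPref.above_subset).cast_ncard_eq.symm
    refine mem_greedyStage_iff.2 ⟨_, ?_, hxS, hxt, (greedyStage_eq_above hS hxt).symm ▸ hind⟩
    exact Set.ncard_lt_ncard
      (LinPref.above_subset.ssubset_of_mem_notMem hxS LinPref.notMem_above_self) hS

namespace IsGreedyChoice

theorem subset (h : IsGreedyChoice M p S Y) : Y ⊆ S := fun x hx => ((h x).1 hx).1

theorem indep (h : IsGreedyChoice M p S Y) (hY : Y.Finite) : M.Indep Y := by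
  rcases Y.eq_empty_or_nonempty with rfl | hne
  · exact M.empty_indep
  obtain ⟨x, hx, hworst⟩ := p.exists_worst hY hne
  refine ((h x).1 hx).2.subset fun y hy => ?_
  rcases eq_or_ne y x with rfl | hyx
  · exact Set.mem_insert _ _
  · exact Or.inr ⟨hy, hworst y hy, hyx⟩

theorem mem_closure_above (h : IsGreedyChoice M p S Y) (hY : Y.Finite) (hx : x ∈ S)
    (hxY : x ∉ Y) (hxE : x ∈ M.E) : x ∈ M.closure (p.above Y x) := by
  by_contra hcl
  have hind := ((h.indep hY).subset LinPref.above_subset).notMem_closure_iff hxE |>.1 hcl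
  exact hxY ((h x).2 ⟨hx, hind.1⟩)

theorem above_inter_ground_subset_closure (h : IsGreedyChoice M p S Y) (hY : Y.Finite) :
    p.above S x ∩ M.E ⊆ M.closure (p.above Y x) := by
  rintro y ⟨⟨hyS, hyx⟩, hyE⟩
  by_cases hy : y ∈ Y
  · exact M.mem_closure_of_mem' ⟨hy, hyx⟩ hyE
  · exact M.closure_subset_closure (LinPref.above_subset_above hyx.1)
      (h.mem_closure_above hY hyS hy hyE)

theorem isBasis' (h : IsGreedyChoice M p S Y) (hY : Y.Finite) : M.IsBasis' Y S := by
  have hind := h.indep hY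
  refine Matroid.isBasis'_iff_isBasis_inter_ground.2
    (hind.isBasis_of_subset_of_subset_closure (Set.subset_inter h.subset hind.subset_ground) ?_)
  rintro x ⟨hx, hxE⟩
  by_cases hxY : x ∈ Y
  · exact M.mem_closure_of_mem' hxY hxE
  · exact M.closure_subset_closure LinPref.above_subset (h.mem_closure_above hY hx hxY hxE)

theorem inter_subset (h : IsGreedyChoice M p S Y) (h' : IsGreedyChoice M p T Z)
    (hY : Y.Finite) (hZ : Z.Finite) (hST : S ⊆ T) : S ∩ Z ⊆ Y := by
  rintro x ⟨hxS, hxZ⟩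
  by_contra hxY
  have hind := ((h' x).1 hxZ).2
  have hxE : x ∈ M.E := hind.subset_ground (Set.mem_insert _ _)
  have hspan : p.above Y x ∩ M.E ⊆ M.closure (p.above Z x) := fun y hy =>
    h'.above_inter_ground_subset_closure hZ ⟨⟨hST (h.subset hy.1.1), hy.1.2⟩, hy.2⟩
  have hxcl : x ∈ M.closure (p.above Z x) := by
    refine M.closure_subset_closure_of_subset_closure hspan ?_
    rw [M.closure_inter_ground]
    exact h.mem_closure_above hY hxS hxY hxE
  refine ((hind.subset (Set.subset_insert _ _)).notMem_closure_iff hxE).2 ?_ hxcl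
  exact ⟨hind, LinPref.notMem_above_self⟩

theorem eq (h : IsGreedyChoice M p S Y) (h' : IsGreedyChoice M p S Z)
    (hY : Y.Finite) (hZ : Z.Finite) : Y = Z :=
  Set.Subset.antisymm
    (fun _ hx => h'.inter_subset h hZ hY Set.Subset.rfl ⟨h.subset hx, hx⟩)
    (fun _ hx => h.inter_subset h' hY hZ Set.Subset.rfl ⟨h'.subset hx, hx⟩)

end IsGreedyChoice

theorem greedyRule_choose_eq_iff (hS : S.Finite) :
    (greedyRule M p).choose S = Y ↔ IsGreedyChoice M p S Y :=
  ⟨fun h => h ▸ isGreedyChoice_greedyRule hS, fun h =>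
    (isGreedyChoice_greedyRule hS).eq h (hS.subset ((greedyRule M p).choose_subset S))
      (hS.subset h.subset)⟩

theorem eRk_lt_encard_iff (hY : Y.Finite) : M.eRk Y < Y.encard ↔ ¬ M.Indep Y := by
  rw [(M.eRk_le_encard Y).lt_iff_ne, M.indep_iff_eRk_eq_encard_of_finite hY]

theorem eRk_insert_eq_eRk_iff (hY : M.Indep Y) (hfin : Y.Finite) (hx : x ∉ Y) :
    M.eRk (insert x Y) = M.eRk Y ↔ ¬ M.Indep (insert x Y) := by
  rw [← eRk_lt_encard_iff (hfin.insert x), Set.encard_insert_of_notMem hx,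
    ENat.lt_add_one_iff hfin.encard_lt_top.ne, ← hY.eRk_eq_encard]
  exact (M.eRk_mono (Set.subset_insert x Y)).ge_iff_eq'.symm

theorem eRk_exchange_lt_eRk_iff (hY : M.Indep Y) (hfin : Y.Finite) (hx : x ∉ Y) (hy : y ∈ Y) :
    M.eRk (insert x (Y \ {y})) < M.eRk Y ↔ ¬ M.Indep (insert x (Y \ {y})) := by
  rw [← eRk_lt_encard_iff (hfin.sdiff.insert x), Set.encard_exchange hx hy, hY.eRk_eq_encard]

theorem not_indep_insert_above_iff (hY : M.Indep Y) (hfin : Y.Finite) (hx : x ∉ Y) :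
    ¬ M.Indep (insert x (p.above Y x)) ↔ M.eRk (Y ∪ {x}) = M.eRk Y ∧
      ∀ y ∈ Y, p.strict x y → M.eRk ((Y \ {y}) ∪ {x}) < M.eRk Y := by
  simp only [Set.union_singleton]
  rw [eRk_insert_eq_eRk_iff hY hfin hx]
  constructor
  · refine fun hdep => ⟨mt (fun h => h.subset ?_) hdep, fun y hy hxy => ?_⟩
    · exact Set.insert_subset_insert LinPref.above_subset
    · refine (eRk_exchange_lt_eRk_iff hY hfin hx hy).2 (mt (fun h => h.subset ?_) hdep)
      refine Set.insert_subset_insert fun z hz => ⟨hz.1, ?_⟩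
      rintro rfl
      exact p.strict_irrefl _ (p.strict_trans hxy hz.2)
  · rintro ⟨hdep, hexch⟩ hind
    have hxE : x ∈ M.E := hind.subset_ground (Set.mem_insert _ _)
    have hxcl : x ∈ M.closure Y := by
      by_contra hcl
      exact hdep ((hY.notMem_closure_iff hxE).1 hcl).1
    -- Exchanging an element of its fundamental circuit for `x` keeps `Y` independent, so the whole
    -- circuit lies in `insert x (p.above Y x)`.
    refine (hY.fundCircuit_isCircuit hxcl hx).not_indep (hind.subset fun y hy => ?_)
    rcases M.fundCircuit_subset_insert x Y hy with rfl | hyY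
    · exact Set.mem_insert _ _
    refine Or.inr ⟨hyY, by_contra fun hyx => ?_⟩
    have hxy : p.strict x y := ⟨p.not_strict_iff.1 hyx, (ne_of_mem_of_not_mem hyY hx).symm⟩
    refine (eRk_exchange_lt_eRk_iff hY hfin hx hyY).1 (hexch y hyY hxy) ?_
    rw [Set.insert_sdiff_singleton_comm hxy.2]
    exact (hY.mem_fundCircuit_iff hxcl hx).1 hy

theorem isGreedyChoice_iff (hYS : Y ⊆ S) (hY : Y.Finite) :
    IsGreedyChoice M p S Y ↔ M.Indep Y ∧ ∀ x ∈ S, x ∉ Y → M.eRk (Y ∪ {x}) = M.eRk Y ∧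
      ∀ y ∈ Y, p.strict x y → M.eRk ((Y \ {y}) ∪ {x}) < M.eRk Y := by
  constructor
  · refine fun h => ⟨h.indep hY, fun x hx hxY => ?_⟩
    exact (not_indep_insert_above_iff (h.indep hY) hY hxY).1 fun hind => hxY ((h x).2 ⟨hx, hind⟩)
  · rintro ⟨hind, h⟩ x
    refine ⟨fun hx => ⟨hYS hx, hind.subset (Set.insert_subset hx LinPref.above_subset)⟩, ?_⟩
    rintro ⟨hxS, hx⟩
    by_contra hxY
    exact (not_indep_insert_above_iff hind hY hxY).2 (h x hxS hxY) hx

end Greedy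

section ChoiceRule

variable {α : Type*} {C : ChoiceRule α} {S T Y : Set α}

/-- Substitutability: a contract chosen from a set is chosen from each subset containing it. -/
def ChoiceRule.Substitutable (C : ChoiceRule α) : Prop :=
  ∀ ⦃S T : Set α⦄, S ⊆ T → S ∩ C.choose T ⊆ C.choose S

/-- Size monotonicity, also known as the law of aggregate demand: at least as many contracts are
chosen from a larger set. -/
def ChoiceRule.SizeMonotonic (C : ChoiceRule α) : Prop :=
  ∀ ⦃S T : Set α⦄, S ⊆ T → (C.choose S).encard ≤ (C.choose T).encard

theorem ChoiceRule.choose_eq_of_subset [Finite α] (hsub : C.Substitutable)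
    (hsize : C.SizeMonotonic) (h : C.choose S = Y) (hYT : Y ⊆ T) (hTS : T ⊆ S) :
    C.choose T = Y := by
  subst h
  exact (Set.Finite.eq_of_subset_of_encard_le (Set.toFinite _)
    (fun _ hx => hsub hTS ⟨hYT hx, hx⟩) (hsize hTS)).symm

theorem ChoiceRule.choose_choose_union [Finite α] (hsub : C.Substitutable)
    (hsize : C.SizeMonotonic) (S T : Set α) : C.choose (C.choose S ∪ T) = C.choose (S ∪ T) := by
  refine ChoiceRule.choose_eq_of_subset hsub hsize rfl (fun x hx => ?_)
    (Set.union_subset_union_left T (C.choose_subset S))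
  exact (C.choose_subset _ hx).imp (fun hxS => hsub Set.subset_union_left ⟨hxS, hx⟩) id

theorem substitutable_greedyRule [Finite α] (M : Matroid α) (p : LinPref α) :
    (greedyRule M p).Substitutable := fun _ _ h =>
  (isGreedyChoice_greedyRule (Set.toFinite _)).inter_subset
    (isGreedyChoice_greedyRule (Set.toFinite _)) (Set.toFinite _) (Set.toFinite _) h

theorem sizeMonotonic_greedyRule [Finite α] (M : Matroid α) (p : LinPref α) :
    (greedyRule M p).SizeMonotonic := by
  intro S T h
  have encard_choose (S : Set α) : ((greedyRule M p).choose S).encard = M.eRk S :=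
    ((isGreedyChoice_greedyRule (Set.toFinite S)).isBasis' (Set.toFinite _)).encard_eq_eRk
  rw [encard_choose, encard_choose]
  exact M.eRk_mono h

end ChoiceRule

section JointChoice

variable {I X : Type*} {inst : X → I} {C : ∀ i, ChoiceRule (InstContract inst i)} {Y W : Set X}

/-- The choice rule of all institutions together, choosing from sets of contracts with arbitrary
institutions. -/
def jointChoice (C : ∀ i, ChoiceRule (InstContract inst i)) : ChoiceRule X where
  choose := accepted C
  choose_subset := accepted_subset C

theorem mem_accepted_iff {i : I} (x : InstContract inst i) :
    (x : X) ∈ accepted C W ↔ x ∈ (C i).choose (instPart inst W i) := by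
  obtain ⟨x, rfl⟩ := x
  exact Iff.rfl

theorem accepted_eq_iff :
    accepted C W = Y ↔ ∀ i, (C i).choose (instPart inst W i) = instPart inst Y i := by
  constructor
  · rintro rfl i
    ext x
    exact (mem_accepted_iff x).symm
  · intro h
    ext x
    exact Set.ext_iff.1 (h (inst x)) ⟨x, rfl⟩

theorem substitutable_jointChoice (hC : ∀ i, (C i).Substitutable) :
    (jointChoice C).Substitutable := fun _ _ h _ hx =>
  hC _ (fun _ hy => h hy) ⟨hx.1, hx.2⟩

theorem sizeMonotonic_jointChoice [Finite X] (hC : ∀ i, (C i).SizeMonotonic) :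
    (jointChoice C).SizeMonotonic := by
  intro S T h
  have hinj (i : I) : ∃ f : InstContract inst i → InstContract inst i,
      (C i).choose (instPart inst S i) ⊆ f ⁻¹' (C i).choose (instPart inst T i) ∧
        Set.InjOn f ((C i).choose (instPart inst S i)) := by
    rcases isEmpty_or_nonempty (InstContract inst i) with _ | _
    · exact ⟨id, fun x => isEmptyElim x, fun x => isEmptyElim x⟩
    · exact Set.Finite.exists_injOn_of_encard_le (Set.toFinite _) (hC i fun _ hx => h hx)
  choose f hf hfinj using hinj
  refine Set.encard_le_encard_of_injOn (f := fun x => (f (inst x) ⟨x, rfl⟩ : X)) ?_ ?_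
  · exact fun x hx => (mem_accepted_iff _).2 (hf _ hx)
  · intro x hx y hy hxy
    have hinst : inst x = inst y := by
      rw [← (f (inst x) ⟨x, rfl⟩).2, ← (f (inst y) ⟨y, rfl⟩).2]
      exact congrArg inst hxy
    have hf_eq : ∀ i (hi : inst x = i), (f i ⟨x, hi⟩ : X) = f (inst x) ⟨x, rfl⟩ := by
      rintro _ rfl
      rfl
    have hxy' : f (inst y) ⟨x, hinst⟩ = f (inst y) ⟨y, rfl⟩ :=
      Subtype.ext ((hf_eq _ hinst).trans hxy)
    have hx' := (mem_accepted_iff (⟨x, hinst⟩ : InstContract inst (inst y))).1 hx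
    exact congrArg Subtype.val (hfinj _ hx' hy hxy')

end JointChoice

section Matching

variable {A X : Type*} {agent : X → A} {μ ν : Matching agent} {R : Profile agent} {a : A}

theorem Matching.assignment_eq_some_iff (μ : Matching agent) (x : AgentContract agent a) :
    μ.assignment a = some x ↔ (x : X) ∈ μ.contracts := by
  unfold Matching.assignment
  split_ifs with h
  · have hunique : ∀ y ∈ agentPart agent μ.contracts a, h.some = y := fun y hy =>
      Set.encard_le_one_iff.1 (μ.card_le_one a) h.some y h.some_mem hy
    rw [Option.some_inj]
    exact ⟨fun hx => hx ▸ h.some_mem, hunique x⟩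
  · exact iff_of_false (by simp) fun hx => h ⟨x, hx⟩

theorem Matching.ext_assignment (h : ∀ a, μ.assignment a = ν.assignment a) : μ = ν := by
  have hcontracts : μ.contracts = ν.contracts := by
    ext x
    let x' : AgentContract agent (agent x) := ⟨x, rfl⟩
    rw [← μ.assignment_eq_some_iff x', ← ν.assignment_eq_some_iff x', h]
  cases μ
  cases ν
  congr

theorem Matching.injOn_agent (μ : Matching agent) : Set.InjOn agent μ.contracts :=
  fun x hx y hy h => (card_le_one_iff agent μ.contracts).1 μ.card_le_one x hx y hy h

theorem Matching.assignment_eq_none_iff (μ : Matching agent) :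
    μ.assignment a = none ↔ a ∉ agent '' μ.contracts := by
  rw [Option.eq_none_iff_forall_ne_some, ← not_exists]
  refine not_congr ⟨?_, ?_⟩
  · rintro ⟨x, hx⟩
    exact ⟨x, (μ.assignment_eq_some_iff x).1 hx, x.2⟩
  · rintro ⟨x, hx, rfl⟩
    exact ⟨⟨x, rfl⟩, (μ.assignment_eq_some_iff _).2 hx⟩

/-- The contracts which their agents find at least as good as their assignments at `μ`. -/
def weaklyDesired (R : Profile agent) (μ : Matching agent) : Set X :=
  {x | (R (agent x)).weak (some ⟨x, rfl⟩) (μ.assignment (agent x))}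

theorem mem_weaklyDesired_iff (x : AgentContract agent a) :
    (x : X) ∈ weaklyDesired R μ ↔ (R a).weak (some x) (μ.assignment a) := by
  obtain ⟨x, rfl⟩ := x
  exact Iff.rfl

theorem contracts_subset_weaklyDesired : μ.contracts ⊆ weaklyDesired R μ := by
  intro x hx
  change (R (agent x)).weak _ _
  rw [(μ.assignment_eq_some_iff ⟨x, rfl⟩).2 hx]
  exact LinPref.weak_refl _ _

theorem strict_assignment_iff (x : AgentContract agent a) :
    (R a).strict (some x) (μ.assignment a) ↔
      (x : X) ∈ weaklyDesired R μ ∧ (x : X) ∉ μ.contracts := by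
  rw [mem_weaklyDesired_iff, ← μ.assignment_eq_some_iff, eq_comm (a := μ.assignment a)]
  exact Iff.rfl

theorem IndividuallyRational.weak_assignment (h : IndividuallyRational R μ)
    {x : Option (AgentContract agent a)} (hx : (R a).weak x none)
    (hbest : ∀ y : AgentContract agent a, (y : X) ∈ μ.contracts → (R a).weak (some y) none →
      (R a).weak x (some y)) : (R a).weak x (μ.assignment a) := by
  have ha := h a
  rcases hy : μ.assignment a with _ | y
  · exact hx
  · exact hbest y ((μ.assignment_eq_some_iff y).1 hy) (hy ▸ ha)

end Matching

section Stability

variable {A I X : Type*} {agent : X → A} {inst : X → I}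
  {C : ∀ i, ChoiceRule (InstContract inst i)} {R : Profile agent} {μ : Matching agent}

/-- Stability of a matching for general choice rules: it is individually rational, and exactly its
contracts are chosen if all contracts which are at least as good as the assignments of their
agents are available. -/
structure IsStable (C : ∀ i, ChoiceRule (InstContract inst i)) (R : Profile agent)
    (μ : Matching agent) : Prop where
  rational : IndividuallyRational R μ
  accepted_eq : accepted C (weaklyDesired R μ) = μ.contracts

theorem accepted_greedyRule_weaklyDesired_eq_iff [Finite X]
    {M : ∀ i, Matroid (InstContract inst i)} {prio : ∀ i, LinPref (InstContract inst i)} :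
    accepted (fun i => greedyRule (M i) (prio i)) (weaklyDesired R μ) = μ.contracts ↔
      Feasible inst M μ ∧ RankMaximal inst M R μ ∧ NoJustifiedEnvyUnderRank inst M prio R μ := by
  have hsub (i : I) : instPart inst μ.contracts i ⊆ instPart inst (weaklyDesired R μ) i :=
    fun _ hx => contracts_subset_weaklyDesired hx
  have hprefers (i : I) (x : InstContract inst i) (hx : x ∉ instPart inst μ.contracts i) :
      PrefersToAssignment R μ x ↔ x ∈ instPart inst (weaklyDesired R μ) i :=
    (strict_assignment_iff ⟨(x : X), rfl⟩).trans (and_iff_left hx)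
  simp only [accepted_eq_iff, greedyRule_choose_eq_iff (Set.toFinite _),
    isGreedyChoice_iff (hsub _) (Set.toFinite _), forall_and]
  refine and_congr_right fun _ => and_congr (forall₂_congr fun i x => ?_)
    ⟨fun h i x hx y hy hp hyx => ?_, fun h i x hxW hx y hy hxy => ?_⟩
  · exact ⟨fun h hx hp => h ((hprefers i x hx).1 hp) hx,
      fun h hxW hx => h hx ((hprefers i x hx).2 hxW)⟩
  · exact h i y ((hprefers i y hy).1 hp) hy x hx hyx
  · exact h i y hy x hx ((hprefers i x hx).2 hxW) hxy

theorem isStable_greedyRule_iff [Finite X] {M : ∀ i, Matroid (InstContract inst i)}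
    {prio : ∀ i, LinPref (InstContract inst i)} :
    IsStable (fun i => greedyRule (M i) (prio i)) R μ ↔
      Feasible inst M μ ∧ RankMaximal inst M R μ ∧ NoJustifiedEnvyUnderRank inst M prio R μ ∧
        IndividuallyRational R μ := by
  constructor
  · intro h
    obtain ⟨hfeas, hmax, henvy⟩ := accepted_greedyRule_weaklyDesired_eq_iff.1 h.accepted_eq
    exact ⟨hfeas, hmax, henvy, h.rational⟩
  · rintro ⟨hfeas, hmax, henvy, hrational⟩
    exact ⟨hrational, accepted_greedyRule_weaklyDesired_eq_iff.2 ⟨hfeas, hmax, henvy⟩⟩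

theorem IsStable.update [Finite X] [DecidableEq A] (hsub : (jointChoice C).Substitutable)
    (hsize : (jointChoice C).SizeMonotonic) (h : IsStable C R μ) {a : A}
    {r : LinPref (Option (AgentContract agent a))} (hrational : r.weak (μ.assignment a) none)
    (hr : ∀ x, r.weak (some x) (μ.assignment a) → (R a).weak (some x) (μ.assignment a)) :
    IsStable C (Function.update R a r) μ := by
  have hW : weaklyDesired (Function.update R a r) μ ⊆ weaklyDesired R μ := by
    intro x hx
    obtain rfl | hxa := eq_or_ne (agent x) a
    · refine hr ⟨x, rfl⟩ ?_
      simpa only [weaklyDesired, Set.mem_ofPred_eq, Function.update_self] using hx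
    · simpa only [weaklyDesired, Set.mem_ofPred_eq, Function.update_of_ne hxa] using hx
  refine ⟨fun b => ?_, ?_⟩
  · obtain rfl | hb := eq_or_ne b a
    · rwa [Function.update_self]
    · rw [Function.update_of_ne hb]
      exact h.rational b
  · exact ChoiceRule.choose_eq_of_subset hsub hsize h.accepted_eq
      contracts_subset_weaklyDesired hW

end Stability

section Restrict

variable {α : Type*} (r : LinPref (Option α)) {S : Set α} {x y : α}

open Classical in
/-- The tier of an alternative when exactly the contracts in `S` are acceptable: first these
contracts, then the null contract, then the other contracts. -/
noncomputable def acceptanceTier (S : Set α) (x : Option α) : ℕ :=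
  x.elim 1 fun x => if x ∈ S then 0 else 2

/-- The preference which declares acceptable exactly the contracts in `S`, and otherwise agrees
with `r`. -/
noncomputable def LinPref.restrict (S : Set α) : LinPref (Option α) where
  weak x y := acceptanceTier S x < acceptanceTier S y ∨
    acceptanceTier S x = acceptanceTier S y ∧ r.weak x y
  total x y := by
    rcases lt_trichotomy (acceptanceTier S x) (acceptanceTier S y) with h | h | h
    · exact Or.inl (Or.inl h)
    · exact (r.total x y).imp (fun hr => Or.inr ⟨h, hr⟩) (fun hr => Or.inr ⟨h.symm, hr⟩)
    · exact Or.inr (Or.inl h)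
  trans x y z hxy hyz := by
    have := r.trans x y z
    grind
  antisymm x y hxy hyx := by
    have := r.antisymm x y
    grind

theorem LinPref.restrict_weak_some_none : (r.restrict S).weak (some x) none ↔ x ∈ S := by
  by_cases hx : x ∈ S <;> simp [LinPref.restrict, acceptanceTier, hx]

theorem LinPref.restrict_weak_some_some (hx : x ∈ S) :
    (r.restrict S).weak (some y) (some x) ↔ y ∈ S ∧ r.weak (some y) (some x) := by
  by_cases hy : y ∈ S <;> simp [LinPref.restrict, acceptanceTier, hx, hy]

/-- The truncation of `r` at `x`: contracts worse than `x` become unacceptable. -/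
noncomputable def LinPref.truncate (x : α) : LinPref (Option α) :=
  r.restrict {y | r.weak (some y) (some x)}

theorem LinPref.truncate_weak_none :
    (r.truncate x).weak (some y) none ↔ r.weak (some y) (some x) :=
  r.restrict_weak_some_none

theorem LinPref.truncate_weak_some {z : α} (h : r.weak (some y) (some x)) :
    (r.truncate x).weak (some z) (some y) ↔ r.weak (some z) (some y) := by
  rw [LinPref.truncate, r.restrict_weak_some_some h]
  exact and_iff_right_of_imp fun hzy => r.trans _ _ _ hzy h

end Restrict

section DeferredAcceptance

variable {A I X : Type*} {agent : X → A} {inst : X → I}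
  {C : ∀ i, ChoiceRule (InstContract inst i)} {R : Profile agent} {μ ν : Matching agent} {a : A}

theorem acceptable_iff (x : AgentContract agent a) :
    Acceptable R (x : X) ↔ (R a).weak (some x) none := by
  obtain ⟨x, rfl⟩ := x
  exact Iff.rfl

theorem isTop_iff (x : AgentContract agent a) :
    IsTop R (x : X) ↔ (R a).weak (some x) none ∧
      ∀ z : AgentContract agent a, (R a).weak (some z) none → (R a).weak (some x) (some z) := by
  obtain ⟨x, rfl⟩ := x
  simp only [IsTop, Subtype.forall, ← acceptable_iff]

theorem isNext_iff (y x : AgentContract agent a) :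
    IsNext R (y : X) x ↔ (R a).weak (some x) none ∧ (R a).strict (some y) (some x) ∧
      ∀ z : AgentContract agent a, (R a).weak (some z) none → (R a).strict (some y) (some z) →
        (R a).weak (some x) (some z) := by
  obtain ⟨x, rfl⟩ := x
  simp only [IsNext, Subtype.forall, ← acceptable_iff, y.2, exists_true_left]

theorem exists_isTop_weak [Finite X] {y : AgentContract agent a} (hy : (R a).weak (some y) none) :
    ∃ x : AgentContract agent a, IsTop R (x : X) ∧ (R a).weak (some x) (some y) := by
  obtain ⟨_, ⟨x, hx, rfl⟩, hbest⟩ := (R a).exists_best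
    (Set.toFinite (some '' {z | (R a).weak (some z) none})) ⟨_, y, hy, rfl⟩
  exact ⟨x, (isTop_iff x).2 ⟨hx, fun z hz => hbest _ ⟨z, hz, rfl⟩⟩, hbest _ ⟨y, hy, rfl⟩⟩

theorem exists_isNext_weak [Finite X] {x y : AgentContract agent a}
    (hy : (R a).weak (some y) none) (hxy : (R a).strict (some x) (some y)) :
    ∃ z : AgentContract agent a, IsNext R (x : X) z ∧ (R a).weak (some z) (some y) := by
  obtain ⟨_, ⟨z, hz, rfl⟩, hbest⟩ := (R a).exists_best (Set.toFinite
    (some '' {z | (R a).weak (some z) none ∧ (R a).strict (some x) (some z)}))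
    ⟨_, y, ⟨hy, hxy⟩, rfl⟩
  refine ⟨z, (isNext_iff x z).2 ⟨hz.1, hz.2, fun w hw hxw => ?_⟩, hbest _ ⟨y, ⟨hy, hxy⟩, rfl⟩⟩
  exact hbest _ ⟨w, ⟨hw, hxw⟩, rfl⟩

theorem acceptable_of_mem_considered {s : ℕ} {x : X} (hx : x ∈ considered C R s) :
    Acceptable R x := by
  induction s with
  | zero => exact hx.1
  | succ s ih =>
    rcases hx with hx | ⟨y, -, -, hx, -⟩
    · exact ih (accepted_subset C _ hx)
    · exact hx

theorem IsStable.considered_subset_weaklyDesired (hsub : (jointChoice C).Substitutable)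
    (h : IsStable C R μ) (s : ℕ) : considered C R s ⊆ weaklyDesired R μ := by
  induction s with
  | zero =>
    refine fun x hx => h.rational.weak_assignment hx.1 fun y _ hy => ?_
    exact ((isTop_iff ⟨x, rfl⟩).1 hx).2 y hy
  | succ s ih =>
    rintro x (hx | ⟨y, ⟨hy, hyrej⟩, hyx⟩)
    · exact ih (accepted_subset C _ hx)
    have hyμ : y ∉ μ.contracts := by
      rw [← h.accepted_eq]
      exact fun hyacc => hyrej (hsub ih ⟨hy, hyacc⟩)
    let y' : AgentContract agent (agent x) := ⟨y, hyx.1⟩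
    obtain ⟨hx, -, hnext⟩ := (isNext_iff y' ⟨x, rfl⟩).1 hyx
    refine h.rational.weak_assignment hx fun z hz hz_acc => hnext z hz_acc ?_
    rw [← (μ.assignment_eq_some_iff z).2 hz]
    exact (strict_assignment_iff y').2 ⟨ih hy, hyμ⟩

variable [Finite X]

theorem accepted_accumulate_considered (hsub : (jointChoice C).Substitutable)
    (hsize : (jointChoice C).SizeMonotonic) (s : ℕ) :
    accepted C (Set.accumulate (considered C R) s) = accepted C (considered C R s) := by
  induction s with
  | zero => rw [Set.accumulate_zero_nat]
  | succ s ih =>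
    rw [Set.accumulate_succ]
    refine (ChoiceRule.choose_choose_union hsub hsize _ _).symm.trans ?_
    have hkept : accepted C (considered C R s) ⊆ considered C R (s + 1) := Set.subset_union_left
    change accepted C (accepted C _ ∪ _) = _
    rw [ih, Set.union_eq_self_of_subset_left hkept]

theorem mem_accumulate_considered_or {y : AgentContract agent a}
    (hy : (R a).weak (some y) none) (s : ℕ) :
    (y : X) ∈ Set.accumulate (considered C R) s ∨ ∃ x : AgentContract agent a,
      (x : X) ∈ considered C R s ∧ (R a).strict (some x) (some y) := by
  induction s with
  | zero =>
    obtain ⟨x, hx, hxy⟩ := exists_isTop_weak hy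
    rcases eq_or_ne x y with rfl | hne
    · exact Or.inl (Set.subset_accumulate hx)
    · exact Or.inr ⟨x, hx, hxy, by simpa using hne⟩
  | succ s ih =>
    rcases ih with hmem | ⟨x, hx, hxy⟩
    · exact Or.inl (Set.monotone_accumulate (Nat.le_succ s) hmem)
    by_cases hacc : (x : X) ∈ accepted C (considered C R s)
    · exact Or.inr ⟨x, Or.inl hacc, hxy⟩
    obtain ⟨z, hz, hzy⟩ := exists_isNext_weak hy hxy
    have hmem : (z : X) ∈ considered C R (s + 1) := Or.inr ⟨x, ⟨hx, hacc⟩, hz⟩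
    rcases eq_or_ne z y with rfl | hne
    · exact Or.inl (Set.subset_accumulate hmem)
    · exact Or.inr ⟨z, hmem, hzy, by simpa using hne⟩

theorem exists_deferredAcceptance_contracts_eq
    (C : ∀ i, ChoiceRule (InstContract inst i)) (R : Profile agent) :
    ∃ s, (deferredAcceptance C R).contracts = considered C R s ∧
      accepted C (considered C R s) = considered C R s := by
  classical
  have hrej := Nat.find_spec (exists_rejected_eq_empty C R)
  have hacc := (accepted_subset C _).antisymm (Set.sdiff_eq_empty.1 hrej)
  exact ⟨_, hacc, hacc⟩

theorem individuallyRational_deferredAcceptance :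
    IndividuallyRational R (deferredAcceptance C R) := by
  intro a
  obtain ⟨s, hs, -⟩ := exists_deferredAcceptance_contracts_eq C R
  rcases hx : (deferredAcceptance C R).assignment a with _ | x
  · exact LinPref.weak_refl _ _
  · rw [Matching.assignment_eq_some_iff, hs] at hx
    exact (acceptable_iff x).1 (acceptable_of_mem_considered hx)

theorem weaklyDesired_deferredAcceptance_subset {s : ℕ}
    (hs : (deferredAcceptance C R).contracts = considered C R s) :
    weaklyDesired R (deferredAcceptance C R) ⊆ Set.accumulate (considered C R) s := by
  intro y hy
  have hacc : Acceptable R y :=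
    (R (agent y)).trans _ _ _ hy (individuallyRational_deferredAcceptance _)
  refine (mem_accumulate_considered_or (y := ⟨y, rfl⟩) hacc s).resolve_right ?_
  rintro ⟨x, hx, hxy⟩
  rw [← hs, ← Matching.assignment_eq_some_iff] at hx
  exact (R (agent y)).not_strict_iff.2 (hx ▸ hy) hxy

theorem isStable_deferredAcceptance (hsub : (jointChoice C).Substitutable)
    (hsize : (jointChoice C).SizeMonotonic) : IsStable C R (deferredAcceptance C R) := by
  obtain ⟨s, hs, hacc⟩ := exists_deferredAcceptance_contracts_eq C R
  refine ⟨individuallyRational_deferredAcceptance,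
    ChoiceRule.choose_eq_of_subset hsub hsize ?_ contracts_subset_weaklyDesired
      (weaklyDesired_deferredAcceptance_subset hs)⟩
  exact (accepted_accumulate_considered hsub hsize s).trans (hacc.trans hs.symm)

theorem IsStable.deferredAcceptance_weak (hsub : (jointChoice C).Substitutable)
    (hsize : (jointChoice C).SizeMonotonic) (h : IsStable C R μ) (a : A) :
    (R a).weak ((deferredAcceptance C R).assignment a) (μ.assignment a) := by
  by_contra hlt
  rw [LinPref.not_weak_iff] at hlt
  rcases hx : μ.assignment a with _ | x
  · exact (R a).not_strict_iff.2 (individuallyRational_deferredAcceptance a) (hx ▸ hlt)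
  have hν := isStable_deferredAcceptance (R := R) hsub hsize
  have hsubset : weaklyDesired R (deferredAcceptance C R) ⊆ weaklyDesired R μ := by
    obtain ⟨s, hs, -⟩ := exists_deferredAcceptance_contracts_eq C R
    refine (weaklyDesired_deferredAcceptance_subset hs).trans fun y hy => ?_
    obtain ⟨t, -, hyt⟩ := Set.mem_accumulate.1 hy
    exact h.considered_subset_weaklyDesired hsub t hyt
  have hxμ : (x : X) ∈ accepted C (weaklyDesired R μ) :=
    h.accepted_eq ▸ (μ.assignment_eq_some_iff x).1 hx
  have hxν : (x : X) ∈ (deferredAcceptance C R).contracts := hν.accepted_eq ▸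
    hsub hsubset ⟨(mem_weaklyDesired_iff x).2 (hx ▸ hlt.1), hxμ⟩
  rw [← Matching.assignment_eq_some_iff] at hxν
  exact hlt.2 (hx.trans hxν.symm)

theorem IsStable.agent_image_eq (hsub : (jointChoice C).Substitutable)
    (hsize : (jointChoice C).SizeMonotonic) (h : IsStable C R μ) :
    agent '' μ.contracts = agent '' (deferredAcceptance C R).contracts := by
  have hν := isStable_deferredAcceptance (R := R) hsub hsize
  have hopt := h.deferredAcceptance_weak hsub hsize
  refine Set.Finite.eq_of_subset_of_encard_le (Set.toFinite _) (fun a ha => ?_) ?_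
  · contrapose ha
    rw [← Matching.assignment_eq_none_iff] at ha ⊢
    exact (R a).antisymm _ _ (h.rational a) (ha ▸ hopt a)
  · rw [(Matching.injOn_agent _).encard_image, (Matching.injOn_agent _).encard_image,
      ← h.accepted_eq, ← hν.accepted_eq]
    refine hsize fun x hx => ?_
    exact (R (agent x)).trans _ _ _ hx (hopt (agent x))

theorem IsStable.assignment_eq_none_iff (hsub : (jointChoice C).Substitutable)
    (hsize : (jointChoice C).SizeMonotonic) (hμ : IsStable C R μ) (hν : IsStable C R ν) :
    μ.assignment a = none ↔ ν.assignment a = none := by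
  rw [Matching.assignment_eq_none_iff, Matching.assignment_eq_none_iff,
    hμ.agent_image_eq hsub hsize, hν.agent_image_eq hsub hsize]

end DeferredAcceptance

section StrategyProofness

variable {A I X : Type*} [Finite X] {agent : X → A} {inst : X → I}
  {C : ∀ i, ChoiceRule (InstContract inst i)} {R : Profile agent} {μ : Matching agent} {a : A}
  {x : AgentContract agent a}

theorem IsStable.update_restrict [DecidableEq A] (hsub : (jointChoice C).Substitutable)
    (hsize : (jointChoice C).SizeMonotonic) (h : IsStable C R μ) (hx : μ.assignment a = some x)
    {S : Set (AgentContract agent a)} (hxS : x ∈ S) :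
    IsStable C (Function.update R a ((R a).restrict S)) μ := by
  refine h.update hsub hsize ?_ fun y hy => ?_
  · rwa [hx, LinPref.restrict_weak_some_none]
  · rw [hx] at hy ⊢
    exact ((R a).restrict_weak_some_some hxS).1 hy |>.2

theorem IsStable.update_restrict_of_eq_none [DecidableEq A] (hsub : (jointChoice C).Substitutable)
    (hsize : (jointChoice C).SizeMonotonic) (h : IsStable C R μ) (hnone : μ.assignment a = none)
    (r : LinPref (Option (AgentContract agent a))) {S : Set (AgentContract agent a)}
    (hS : ∀ y ∈ S, (R a).weak (some y) none) :
    IsStable C (Function.update R a (r.restrict S)) μ := by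
  refine h.update hsub hsize ?_ fun y hy => ?_
  · rw [hnone]
    exact LinPref.weak_refl _ _
  · rw [hnone] at hy ⊢
    exact hS y (r.restrict_weak_some_none.1 hy)

theorem deferredAcceptance_truncate_eq_none [DecidableEq A] (hsub : (jointChoice C).Substitutable)
    (hsize : (jointChoice C).SizeMonotonic)
    (hx : (R a).strict (some x) ((deferredAcceptance C R).assignment a)) :
    (deferredAcceptance C (Function.update R a ((R a).truncate x))).assignment a = none := by
  set R' := Function.update R a ((R a).truncate x) with hR'
  have hstable : IsStable C R' (deferredAcceptance C R') := isStable_deferredAcceptance hsub hsize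
  have hR'a : R' a = (R a).truncate x := Function.update_self a _ R
  have hrational := hstable.rational a
  rcases hy : (deferredAcceptance C R').assignment a with _ | y
  · rfl
  rw [hy, hR'a, LinPref.truncate_weak_none] at hrational
  have hR : Function.update R' a (R a) = R := by
    rw [hR', Function.update_idem, Function.update_eq_self]
  have hstableR : IsStable C R (deferredAcceptance C R') := by
    rw [← hR]
    refine hstable.update hsub hsize ?_ fun z hz => ?_
    · rw [hy]
      refine (R a).trans _ _ _ hrational ((R a).trans _ _ _ hx.1 ?_)
      exact (isStable_deferredAcceptance hsub hsize).rational a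
    · rw [hy] at hz ⊢
      rwa [hR'a, LinPref.truncate_weak_some _ hrational]
  have hopt := hstableR.deferredAcceptance_weak hsub hsize a
  rw [hy] at hopt
  exact absurd ((R a).trans _ _ _ hopt hrational) ((R a).not_weak_iff.2 hx)

theorem strategyProof_deferredAcceptance (hsub : (jointChoice C).Substitutable)
    (hsize : (jointChoice C).SizeMonotonic) :
    StrategyProof (deferredAcceptance (agent := agent) C) := by
  classical
  intro R a Ra'
  by_contra hlt
  rw [LinPref.not_weak_iff] at hlt
  have hstable (R : Profile agent) : IsStable C R (deferredAcceptance C R) :=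
    isStable_deferredAcceptance hsub hsize
  rcases hz : (deferredAcceptance C (Function.update R a Ra')).assignment a with _ | z
  · exact (R a).not_strict_iff.2 ((hstable R).rational a) (hz ▸ hlt)
  -- If only `z` is acceptable to `a`, then `a` is assigned `z` at one stable matching and
  -- nothing at another one.
  let R₁ := Function.update R a (Ra'.restrict {z})
  have hassigned : IsStable C R₁ (deferredAcceptance C (Function.update R a Ra')) := by
    have h := (hstable (Function.update R a Ra')).update_restrict hsub hsize hz
      (Set.mem_singleton z)
    rwa [Function.update_idem, Function.update_self] at h
  let R₂ := Function.update R a ((R a).truncate z)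
  have hnone : (deferredAcceptance C R₂).assignment a = none :=
    deferredAcceptance_truncate_eq_none hsub hsize (hz ▸ hlt)
  have hunassigned : IsStable C R₁ (deferredAcceptance C R₂) := by
    have hacc : ∀ y ∈ ({z} : Set (AgentContract agent a)), (R₂ a).weak (some y) none := by
      rintro y rfl
      simp only [R₂, Function.update_self, LinPref.truncate_weak_none]
      exact (R a).weak_refl _
    have h := (hstable R₂).update_restrict_of_eq_none hsub hsize hnone Ra' hacc
    rwa [Function.update_idem] at h
  have hz_none := (hassigned.assignment_eq_none_iff hsub hsize hunassigned).2 hnone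
  exact Option.some_ne_none z (hz.symm.trans hz_none)

theorem StrategyProof.eq_deferredAcceptance {φ : MatchingRule agent}
    (hsub : (jointChoice C).Substitutable) (hsize : (jointChoice C).SizeMonotonic)
    (hstable : ∀ R, IsStable C R (φ R)) (hφ : StrategyProof φ) : φ = deferredAcceptance C := by
  classical
  refine funext fun R => Matching.ext_assignment fun a => ?_
  have hν : IsStable C R (deferredAcceptance C R) := isStable_deferredAcceptance hsub hsize
  have hopt := (hstable R).deferredAcceptance_weak hsub hsize a
  refine (R a).antisymm _ _ ?_ hopt
  rcases hx : (deferredAcceptance C R).assignment a with _ | x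
  · exact (hstable R).rational a
  let R' := Function.update R a ((R a).truncate x)
  have hνR' : IsStable C R' (deferredAcceptance C R) :=
    hν.update_restrict hsub hsize hx ((R a).weak_refl _)
  have hR'a : R' a = (R a).truncate x := Function.update_self a _ R
  have hrational := (hstable R').rational a
  have hmanip := hφ R a ((R a).truncate x)
  rcases hy : (φ R').assignment a with _ | y
  · have hnone := (hνR'.assignment_eq_none_iff hsub hsize (hstable R')).2 hy
    exact absurd (hx.symm.trans hnone) (Option.some_ne_none x)
  · have hyx : (R a).weak (some y) (some x) := by
      rwa [hy, hR'a, LinPref.truncate_weak_none] at hrational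
    exact (R a).trans _ _ _ hmanip (hy ▸ hyx)

theorem isStable_and_strategyProof_iff {φ : MatchingRule agent}
    (hsub : (jointChoice C).Substitutable) (hsize : (jointChoice C).SizeMonotonic) :
    (∀ R, IsStable C R (φ R)) ∧ StrategyProof φ ↔ φ = deferredAcceptance C := by
  constructor
  · rintro ⟨hstable, hφ⟩
    exact hφ.eq_deferredAcceptance hsub hsize hstable
  · rintro rfl
    exact ⟨fun _ => isStable_deferredAcceptance hsub hsize,
      strategyProof_deferredAcceptance hsub hsize⟩

end StrategyProofness

end MatchingContracts

theorem mainTheorem6 {A I X : Type*} [Finite X] (agent : X → A) (inst : X → I)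
    (M : ∀ i, Matroid (InstContract inst i)) (hM : ∀ i, (M i).E = Set.univ)
    (prio : ∀ i, LinPref (InstContract inst i)) (φ : MatchingRule agent) :
    ((∀ R, Feasible inst M (φ R)) ∧
      (∀ R, RankMaximal inst M R (φ R)) ∧
      (∀ R, NoJustifiedEnvyUnderRank inst M prio R (φ R)) ∧
      (∀ R, IndividuallyRational R (φ R)) ∧
      StrategyProof φ) ↔
    φ = deferredAcceptance (fun i => greedyRule (M i) (prio i)) := by
  have hsub : (jointChoice fun i => greedyRule (M i) (prio i)).Substitutable :=
    substitutable_jointChoice fun i => substitutable_greedyRule (M i) (prio i)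
  have hsize : (jointChoice fun i => greedyRule (M i) (prio i)).SizeMonotonic :=
    sizeMonotonic_jointChoice fun i => sizeMonotonic_greedyRule (M i) (prio i)
  rw [← isStable_and_strategyProof_iff hsub hsize]
  simp only [isStable_greedyRule_iff, forall_and, and_assoc]
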